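/- Let $(E,d)$ be a complete separable metric space with its Borel $\sigma$-algebra and $\mu$ a probability measure on $E$. For $B\subset E$ and $\varepsilon>0$ put $B^\varepsilon=\{x:\exists y\in B,\ d(x,y)<\varepsilon\}$; for sets $B_n\subset E$ put $\lim_n B_n=\bigcap_{\varepsilon>0}\bigcup_{k\ge1}\bigcap_{n\ge k}B_n^\varepsilon$; for subsets $A,B$ of an (extended pseudo-)metric space put $\mathrm{Haus}(A|B)=\inf\{\varepsilon>0: A\subset B^\varepsilon\}\in[0,\infty]$. Let $\mathcal F$ be a stable class of closed subsets of $E$, i.e. $E\in\mathcal F$ and for every sequence $(B_n)_{n\ge 1}$ in $\mathcal F$ there are indices $n_k\to\infty$ with $\lim_k B_{n_k}\in\mathcal F$. Let $d_{\mathcal F}$ be a metric (possibly an extended pseudo-metric) on $\mathcal F$, and let $\tau:\mathcal F\to[0,\infty]$. For a probability measure $\nu$ on $E$ put $$\tau^a_\nu=\inf\{\tau(A):A\in\mathcal F,\ \nu(A)\ge 1-a\},\qquad \mathcal S^a_\nu=\operatorname{argmin}\{\tau(A):A\in\mathcal F,\ \nu(A)\ge1-a\},$$ and assume $\tau^a:=\tau^a_\mu<\infty$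 for all $0<a<1$. Fix $0<\alpha<1$ and suppose: - (H2) for every decreasing sequence $(A_n)_{n\ge1}$ in $\mathcal F$ with $\tau(A_1)<\infty$ and $\mathrm{Haus}(A_n|\bigcap_kA_k)\to0$ one has $\tau(A_n)\to\tau(\bigcap_k A_k)$; - (H3) $\tau(\lim_nA_n)\le\liminf_n\tau(A_n)$ for every sequence $(A_n)$ in $\mathcal F$ with $\lim_nA_n\in\mathcal F$; - (H4) $a\mapsto\tau^a$ is continuous at $\alpha$; - (H5) for every sequence $(A_n)$ in $\mathcal F$ with $\lim_nA_n\in\mathcal F$ and $\tau(\lim_nA_n)<\infty$: if $\tau(A_n)\to\tau(\lim_kA_k)$, then $d_{\mathcal F}(A_n,\lim_kA_k)\to0$; - (H6) every $A\in\mathcal F$ with $\tau(A)<\infty$ is totally bounded. Let $(X_n)_{n\ge1}$ be a time-homogeneous Markov chain in $E$ with transition kernel $\kappa$ and invariant probability measure $\mu$, ergodic in one of the following two senses: either (i) every Borel set $A$ with $\kappa(x,A)=1_A(x)$ for $\mu$-a.e. $x$ has $\mu(A)\in\{0,1\}$, and the law of $X_1$ is absolutely continuous with respect to $\mu$ (e.g.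 the chain is stationary); or (ii) $\kappa^n(x,\cdot)\to\mu$ in total variation for every $x\in E$ (and the law of $X_1$ is arbitrary). Let $\mu_n=\frac1n\sum_{1\le i\le n}\delta_{X_i}$ and write $\mathcal S^\alpha=\mathcal S^\alpha_\mu$, $\mathcal S^\alpha_n=\mathcal S^\alpha_{\mu_n}$. Then, almost surely, $$\mathrm{Haus}(\mathcal S^\alpha_n|\mathcal S^\alpha)\to0\quad\text{as }n\to\infty,$$ where the Hausdorff contrast of subsets of $\mathcal F$ is taken with respect to $d_{\mathcal F}$. -/

import Mathlib

open MeasureTheory ProbabilityTheory Filter Topology Set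
open scoped ENNReal

noncomputable section

namespace MassLoc

/-- Hausdorff contrast `Haus(A|B) = inf {ε > 0 | A ⊆ B^ε}`, with values in `[0,∞]` (`inf ∅ = ∞`).
`Metric.thickening ε B` is the open neighbourhood `B^ε = {x | ∃ y ∈ B, d(x,y) < ε}`. -/
def hausContrast {X : Type*} [PseudoEMetricSpace X] (A B : Set X) : ℝ≥0∞ :=
  ⨅ (ε : ℝ) (_ : 0 < ε) (_ : A ⊆ Metric.thickening ε B), ENNReal.ofReal ε

section Classes

variable {E : Type*} [MetricSpace E]

/-- `lim_n B_n = ⋂_{ε>0} ⋃_k ⋂_{n≥k} B_n^ε`. -/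
def setLim (B : ℕ → Set E) : Set E :=
  ⋂ (ε : ℝ) (_ : 0 < ε), ⋃ k : ℕ, ⋂ (n : ℕ) (_ : k ≤ n), Metric.thickening ε (B n)

/-- A stable class of closed sets. -/
structure IsStable (𝓕 : Set (Set E)) : Prop where
  isClosed : ∀ A ∈ 𝓕, IsClosed A
  univ_mem : Set.univ ∈ 𝓕
  exists_lim_mem : ∀ B : ℕ → Set E, (∀ n, B n ∈ 𝓕) →
    ∃ φ : ℕ → ℕ, Tendsto φ atTop atTop ∧ setLim (fun k => B (φ k)) ∈ 𝓕

variable {𝓕 : Set (Set E)}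

/-- Continuity of the size along decreasing sequences that converge for the contrast. -/
def DecreasingContinuous (τ : 𝓕 → ℝ≥0∞) : Prop :=
  ∀ A : ℕ → 𝓕, Antitone A → τ (A 0) < ∞ →
    Tendsto (fun n => hausContrast (A n : Set E) (⋂ k, (A k : Set E))) atTop (𝓝 0) →
    ∀ h : (⋂ k, (A k : Set E)) ∈ 𝓕,
      Tendsto (fun n => τ (A n)) atTop (𝓝 (τ ⟨⋂ k, (A k : Set E), h⟩))

/-- Lower semicontinuity of the size, `τ(lim A_n) ≤ liminf τ(A_n)`, whenever `lim A_n`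
belongs to the domain of `τ`. -/
def LimLowerSemicontinuous (τ : 𝓕 → ℝ≥0∞) : Prop :=
  ∀ (A : ℕ → 𝓕) (h : setLim (fun n => (A n : Set E)) ∈ 𝓕),
    τ ⟨setLim (fun n => (A n : Set E)), h⟩ ≤ liminf (fun n => τ (A n)) atTop

/-- If `lim A_n ∈ 𝓕` has finite size and `τ(A_n) → τ(lim A_n)`, then `d_𝓕(A_n, lim A_k) → 0`. -/
def SizeConvImpliesDistConv [PseudoEMetricSpace 𝓕] (τ : 𝓕 → ℝ≥0∞) : Prop :=
  ∀ (A : ℕ → 𝓕) (h : setLim (fun n => (A n : Set E)) ∈ 𝓕),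
    τ ⟨setLim (fun n => (A n : Set E)), h⟩ < ∞ →
    Tendsto (fun n => τ (A n)) atTop (𝓝 (τ ⟨setLim (fun n => (A n : Set E)), h⟩)) →
    Tendsto (fun n => edist (A n) ⟨setLim (fun n => (A n : Set E)), h⟩) atTop (𝓝 0)

/-- Sets of finite size are totally bounded. -/
def FiniteSizeTotallyBounded (τ : 𝓕 → ℝ≥0∞) : Prop :=
  ∀ A : 𝓕, τ A < ∞ → TotallyBounded (A : Set E)

variable [MeasurableSpace E]

/-- `τ^α = inf {τ(A) ; A ∈ 𝓕, μ(A) ≥ 1 - α}`. -/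
def minSize (τ : 𝓕 → ℝ≥0∞) (μ : Measure E) (α : ℝ) : ℝ≥0∞ :=
  ⨅ (A : 𝓕) (_ : 1 - α ≤ μ.real (A : Set E)), τ A

/-- `argmin {τ(A) ; A ∈ 𝓕, μ(A) ≥ 1 - α}`. -/
def minimizers (τ : 𝓕 → ℝ≥0∞) (μ : Measure E) (α : ℝ) : Set 𝓕 :=
  {A | 1 - α ≤ μ.real (A : Set E) ∧ ∀ B : 𝓕, 1 - α ≤ μ.real (B : Set E) → τ A ≤ τ B}

end Classes

section Chains

variable {E Ω : Type*} [MeasurableSpace E] [MeasurableSpace Ω]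

/-- Empirical measure `n⁻¹ ∑ δ_{x_i}` of the first `n` points of the sequence `x`. -/
def empiricalMeasure (x : ℕ → E) (n : ℕ) : Measure E :=
  (n : ℝ≥0∞)⁻¹ • ∑ i ∈ Finset.range n, Measure.dirac (x i)

/-- `X` is a (time-homogeneous) Markov chain with transition kernel `κ`, for its own history. -/
structure IsMarkovChain (X : ℕ → Ω → E) (κ : Kernel E E) (P : Measure Ω) : Prop where
  measurable : ∀ n, Measurable (X n)
  condExp_eq : ∀ (n : ℕ) (A : Set E), MeasurableSet A →
    P[(X (n + 1) ⁻¹' A).indicator (fun _ => (1 : ℝ)) |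
        ⨆ (i : ℕ) (_ : i ≤ n), MeasurableSpace.comap (X i) inferInstance]
      =ᵐ[P] fun ω => (κ (X n ω)).real A

/-- Every set `A` with `κ(·, A) = 1_A` `μ`-almost everywhere has `μ`-measure `0` or `1`. -/
def TrivialInvariantSets (κ : Kernel E E) (μ : Measure E) : Prop :=
  ∀ A : Set E, MeasurableSet A → (fun x => κ x A) =ᵐ[μ] A.indicator (fun _ => 1) →
    μ A = 0 ∨ μ A = 1

/-- From every starting point the `n`-step transition probabilities converge to `μ` in total
variation: `sup_A |κⁿ(x, A) - μ(A)| → 0` for every `x`. -/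
def ConvergesInTotalVariation (κ : Kernel E E) (μ : Measure E) : Prop :=
  ∀ x : E, Tendsto
    (fun n : ℕ => ⨆ (A : Set E) (_ : MeasurableSet A),
      ENNReal.ofReal |((κ ^ n) x).real A - μ.real A|) atTop (𝓝 0)

/-- `X` is an ergodic Markov chain with transition kernel `κ` and invariant measure `μ`, in either
of the two usual senses: `μ` is an ergodic invariant measure and the initial law is absolutely
continuous with respect to `μ` (for instance, the chain is stationary), or `κⁿ(x, ·)` converges to
`μ` in total variation for every `x` (and the initial law is arbitrary). -/
structure IsErgodicMarkovChain (X : ℕ → Ω → E) (κ : Kernel E E) (μ : Measure E)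
    (P : Measure Ω) : Prop where
  isMarkovChain : IsMarkovChain X κ P
  invariant : κ.Invariant μ
  ergodic : (TrivialInvariantSets κ μ ∧ P.map (X 0) ≪ μ) ∨ ConvergesInTotalVariation κ μ

end Chains

end MassLoc

end

noncomputable section

namespace MassLoc

/-! The proof separates a deterministic compactness argument from a law of large numbers.

Deterministic part (`tendsto_hausContrast_minimizers`). Suppose that, for infinitely many `n`, some
empirical minimizer `C n` stays at distance at least `ε` from all minimizers for `μ`. A diagonal
extraction makes every basic open set either eventually hit or eventually avoided by these sets, and
stability then gives a further subsequence with limit `A` in the class. The complement of `A` is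
covered by avoided basic sets, so convergence of the masses of finite unions of basic sets gives `A`
mass at least `1 - α` (`le_measureReal_setLim`). Conversely, continuity of the minimal size at `α`
provides countably many sets `D j` of mass strictly above `1 - α` and of nearly minimal size
(`exists_seq_tendsto_minSize`). Each `D j` is eventually a competitor for the empirical problem, so
the limsup of the sizes of the `C n` is at most the minimal size. With lower semicontinuity, `A` is
a minimizer and the sizes converge to `τ A`; H5 then brings `C n` close to `A`, a contradiction.
Only countably many test sets occur, so almost sure convergence of frequencies for each fixed set
suffices.

Probabilistic part (`IsErgodicMarkovChain.ae_tendsto_empiricalMeasure`). The chain is moved to path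
space, where its law is a mixture of the laws `pathKernel κ x`. Under the stationary law the shift
is ergodic (`ergodic_shift`), because the probability of a shift-invariant event is a harmonic
function of the starting point, hence almost everywhere constant. Birkhoff's theorem, obtained from
the maximal ergodic inequality, then gives convergence from almost every starting point. Absolute
continuity of the initial law or convergence in total variation removes the exceptional starting
points. -/

lemma exists_subseq_eventually_iff (p : ℕ → ℕ → Prop) :
    ∃ (a : ℕ → Prop) (φ : ℕ → ℕ), StrictMono φ ∧ ∀ i, ∀ᶠ k in atTop, (p (φ k) i ↔ a i) := by
  classical
  -- Sequential compactness of the Cantor space `ℕ → Bool` replaces an explicit diagonal argument.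
  obtain ⟨a, φ, hφ, h⟩ := CompactSpace.tendsto_subseq (fun n i => decide (p n i))
  refine ⟨fun i => a i = true, φ, hφ, fun i => ?_⟩
  have h1 := (tendsto_pi_nhds.1 h) i
  rw [nhds_discrete, tendsto_pure] at h1
  filter_upwards [h1] with k hk
  simp only [Function.comp_apply] at hk
  rw [← hk, decide_eq_true_iff]

/-! ### Limits of closed sets and their mass -/

section Limits

variable {E : Type*} [MetricSpace E]

lemma exists_frequently_notMem_thickening {B : ℕ → Set E} {x : E} (hx : x ∉ setLim B) :
    ∃ ε > 0, ∃ᶠ n in atTop, x ∉ Metric.thickening ε (B n) := by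
  simp only [setLim, mem_iInter, mem_iUnion, not_forall, not_exists] at hx
  obtain ⟨ε, hε, h⟩ := hx
  refine ⟨ε, hε, frequently_atTop.2 fun k => ?_⟩
  obtain ⟨n, hkn, hn⟩ := h k
  exact ⟨n, hkn, hn⟩

/-- Along a sequence of sets for which every basic open set is either eventually hit or eventually
avoided, the limit of any subsequence contains all points without an avoided neighbourhood. -/
lemma compl_setLim_subset_iUnion {b : ℕ → Set E} (hb : TopologicalSpace.IsTopologicalBasis (range b))
    {B : ℕ → Set E} {a : ℕ → Prop} (ha : ∀ i, ∀ᶠ k in atTop, ((b i ∩ B k).Nonempty ↔ a i))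
    {φ : ℕ → ℕ} (hφ : Tendsto φ atTop atTop) :
    (setLim fun k => B (φ k))ᶜ ⊆ ⋃ (i : ℕ) (_ : ¬ a i), b i := by
  intro x hx
  obtain ⟨ε, hε, h⟩ := exists_frequently_notMem_thickening hx
  obtain ⟨_, ⟨i, rfl⟩, hxi, hi⟩ :=
    hb.exists_subset_of_mem_open (Metric.mem_ball_self (x := x) hε) Metric.isOpen_ball
  obtain ⟨k, hk, hki⟩ := (h.and_eventually (hφ.eventually (ha i))).exists
  refine mem_iUnion₂.2 ⟨i, fun hai => ?_, hxi⟩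
  obtain ⟨y, hyi, hy⟩ := hki.2 hai
  exact hk (Metric.mem_thickening_iff.2 ⟨y, hy, by
    rw [dist_comm]; exact Metric.mem_ball.1 (hi hyi)⟩)

variable [MeasurableSpace E] [BorelSpace E]

/-- Upper semicontinuity of the mass of closed sets under weak convergence, tested on finite
unions of basic open sets. -/
lemma le_measureReal_setLim {μ : Measure E} [IsProbabilityMeasure μ] {m : ℕ → Measure E}
    [∀ n, IsProbabilityMeasure (m n)] {b : ℕ → Set E}
    (hb : TopologicalSpace.IsTopologicalBasis (range b))
    (hm : ∀ s : Finset ℕ, Tendsto (fun n => (m n).real (⋃ i ∈ s, b i)) atTop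
      (𝓝 (μ.real (⋃ i ∈ s, b i))))
    {B : ℕ → Set E} (hB : ∀ n, IsClosed (B n)) {c : ℝ} (hc : ∀ n, c ≤ (m n).real (B n))
    {a : ℕ → Prop} (ha : ∀ i, ∀ᶠ k in atTop, ((b i ∩ B k).Nonempty ↔ a i))
    {φ : ℕ → ℕ} (hφ : Tendsto φ atTop atTop) (hcl : IsClosed (setLim fun k => B (φ k))) :
    c ≤ μ.real (setLim fun k => B (φ k)) := by
  classical
  let s : ℕ → Finset ℕ := fun N => (Finset.range N).filter fun i => ¬ a i
  have hs : Monotone fun N => ⋃ i ∈ s N, b i := fun M N h =>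
    biUnion_subset_biUnion_left fun i hi => by
      simp only [s, Finset.coe_filter, Finset.mem_range, mem_ofPred_eq] at hi ⊢
      exact ⟨hi.1.trans_le h, hi.2⟩
  have hU : (⋃ N, ⋃ i ∈ s N, b i) = ⋃ (i : ℕ) (_ : ¬ a i), b i := by
    ext x
    simp only [mem_iUnion, s, Finset.mem_filter, Finset.mem_range, exists_prop]
    exact ⟨fun ⟨_, i, h, hx⟩ => ⟨i, h.2, hx⟩, fun ⟨i, h, hx⟩ => ⟨i + 1, i, ⟨i.lt_succ_self, h⟩, hx⟩⟩
  have hfin : ∀ N, μ.real (⋃ i ∈ s N, b i) ≤ 1 - c := fun N => by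
    refine le_of_tendsto (hm (s N)) ?_
    -- The time from which a basic set is avoided depends on the set, hence the restriction to
    -- finitely many and the passage `N → ∞` afterwards.
    have : ∀ᶠ k in atTop, ∀ i ∈ s N, ((b i ∩ B k).Nonempty ↔ a i) :=
      (s N).eventually_all.2 fun i _ => ha i
    filter_upwards [this] with k hk
    have hsub : (⋃ i ∈ s N, b i) ⊆ (B k)ᶜ := iUnion₂_subset fun i hi x hx hxB =>
      (Finset.mem_filter.1 hi).2 ((hk i hi).1 ⟨x, hx, hxB⟩)
    calc (m k).real (⋃ i ∈ s N, b i) ≤ (m k).real (B k)ᶜ := measureReal_mono hsub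
      _ = 1 - (m k).real (B k) := probReal_compl_eq_one_sub (hB k).measurableSet
      _ ≤ 1 - c := by linarith [hc k]
  have hlim : μ.real (⋃ (i : ℕ) (_ : ¬ a i), b i) ≤ 1 - c := by
    rw [← hU]
    have ht := (ENNReal.tendsto_toReal (measure_ne_top μ _)).comp
      (tendsto_measure_iUnion_atTop (μ := μ) hs)
    exact le_of_tendsto ht (Eventually.of_forall hfin)
  have h1 : μ.real (setLim fun k => B (φ k))ᶜ ≤ 1 - c :=
    (measureReal_mono (compl_setLim_subset_iUnion hb ha hφ) (measure_ne_top _ _)).trans hlim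
  rw [probReal_compl_eq_one_sub hcl.measurableSet] at h1
  linarith

end Limits

lemma tendsto_hausContrast_zero {X : Type*} [PseudoEMetricSpace X] {A : ℕ → Set X} {B : Set X}
    (h : ∀ ε : ℝ, 0 < ε → ∀ᶠ n in atTop, A n ⊆ Metric.thickening ε B) :
    Tendsto (fun n => hausContrast (A n) B) atTop (𝓝 0) := by
  refine ENNReal.tendsto_nhds_zero.2 fun ε hε => ?_
  obtain ⟨δ, hδ, hδε⟩ : ∃ δ : ℝ, 0 < δ ∧ ENNReal.ofReal δ ≤ ε := by
    obtain ⟨δ, hδ, hδε⟩ := ENNReal.lt_iff_exists_nnreal_btwn.1 hε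
    exact ⟨δ, by exact_mod_cast hδ, by simpa using hδε.le⟩
  filter_upwards [h δ hδ] with n hn
  exact (iInf₂_le_of_le δ hδ (iInf_le _ hn)).trans hδε

/-! ### Consistency of minimizers for a fixed sequence of measures -/

section Deterministic

variable {E : Type*} [MeasurableSpace E] {𝓕 : Set (Set E)}

lemma minSize_le {τ : 𝓕 → ℝ≥0∞} {μ : Measure E} {a : ℝ} {A : 𝓕}
    (h : 1 - a ≤ μ.real (A : Set E)) : minSize τ μ a ≤ τ A := iInf₂_le A h

/-- Sets of mass larger than `1 - α` whose sizes approach the minimal size at level `α`. -/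
lemma exists_seq_tendsto_minSize {τ : 𝓕 → ℝ≥0∞} {μ : Measure E} {α : ℝ} (hα : 0 < α) (hα1 : α < 1)
    (hfin : ∀ a : ℝ, 0 < a → a < 1 → minSize τ μ a < ∞)
    (H4 : ContinuousAt (fun a : ℝ => minSize τ μ a) α) :
    ∃ A : ℕ → 𝓕, (∀ j, 1 - α < μ.real (A j : Set E)) ∧
      ∀ t, (∀ j, t ≤ τ (A j)) → t ≤ minSize τ μ α := by
  -- The shift by `2` keeps every level strictly between `0` and `α`, including `j = 0`. A level
  -- below `α` yields mass strictly above `1 - α`.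
  let a : ℕ → ℝ := fun j => α - α * (1 / ((j : ℝ) + 2))
  have hpos : ∀ j : ℕ, 0 < 1 / ((j : ℝ) + 2) := fun j => by positivity
  have hlt1 : ∀ j : ℕ, 1 / ((j : ℝ) + 2) < 1 := fun j => by
    rw [div_lt_one (by positivity)]
    linarith [(Nat.cast_nonneg j : (0 : ℝ) ≤ j)]
  have ha0 : ∀ j, 0 < a j := fun j => by
    have := mul_lt_mul_of_pos_left (hlt1 j) hα
    simp only [a]; linarith
  have haα : ∀ j, a j < α := fun j => by
    have := mul_pos hα (hpos j)
    simp only [a]; linarith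
  have hlim : Tendsto a atTop (𝓝 α) := by
    have h1 : Tendsto (fun j : ℕ => 1 / ((j : ℝ) + 2)) atTop (𝓝 0) := by
      simpa [Function.comp_def] using
        (tendsto_inv_atTop_zero.comp
          (tendsto_atTop_add_const_right _ (2 : ℝ) tendsto_natCast_atTop_atTop))
    simpa [a] using (tendsto_const_nhds (x := α)).sub (h1.const_mul α)
  have hex : ∀ j : ℕ, ∃ A : 𝓕, 1 - a j ≤ μ.real (A : Set E) ∧
      τ A < minSize τ μ (a j) + ((j : ℝ≥0∞) + 1)⁻¹ := fun j => by
    have h := ENNReal.lt_add_right (hfin (a j) (ha0 j) ((haα j).trans hα1)).ne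
      (b := ((j : ℝ≥0∞) + 1)⁻¹) (by simp)
    conv_lhs at h => rw [minSize]
    simp only [iInf_lt_iff] at h
    obtain ⟨A, hA, h⟩ := h
    exact ⟨A, hA, h⟩
  choose A hA hτ using hex
  refine ⟨A, fun j => by linarith [hA j, haα j], fun t ht => ?_⟩
  have h2 : Tendsto (fun j : ℕ => minSize τ μ (a j) + ((j : ℝ≥0∞) + 1)⁻¹) atTop
      (𝓝 (minSize τ μ α + 0)) := by
    refine (H4.tendsto.comp hlim).add ?_
    have := (ENNReal.tendsto_inv_nat_nhds_zero).comp (tendsto_add_atTop_nat 1)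
    simpa [Function.comp_def] using this
  rw [add_zero] at h2
  exact ge_of_tendsto' h2 fun j => (ht j).trans (hτ j).le

variable [MetricSpace E] [BorelSpace E] [PseudoEMetricSpace 𝓕]

/-- Consistency of minimizers for a deterministic sequence of measures. -/
theorem tendsto_hausContrast_minimizers {μ : Measure E} [IsProbabilityMeasure μ]
    (h𝓕 : IsStable 𝓕) {τ : 𝓕 → ℝ≥0∞} {m : ℕ → Measure E}
    (hprob : ∀ᶠ n in atTop, IsProbabilityMeasure (m n)) {b : ℕ → Set E}
    (hb : TopologicalSpace.IsTopologicalBasis (range b))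
    (hm : ∀ s : Finset ℕ, Tendsto (fun n => (m n).real (⋃ i ∈ s, b i)) atTop
      (𝓝 (μ.real (⋃ i ∈ s, b i))))
    {α : ℝ} (hfin : minSize τ μ α < ∞) {D : ℕ → 𝓕}
    (hD : ∀ j, 1 - α < μ.real (D j : Set E))
    (hDτ : ∀ t, (∀ j, t ≤ τ (D j)) → t ≤ minSize τ μ α)
    (hmD : ∀ j, Tendsto (fun n => (m n).real (D j : Set E)) atTop (𝓝 (μ.real (D j : Set E))))
    (H3 : LimLowerSemicontinuous τ) (H5 : SizeConvImpliesDistConv τ) :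
    Tendsto (fun n => hausContrast (minimizers τ (m n) α) (minimizers τ μ α)) atTop (𝓝 0) := by
  refine tendsto_hausContrast_zero fun ε hε => ?_
  by_contra hcon
  rw [not_eventually] at hcon
  obtain ⟨ψ, hψ, hψb⟩ := extraction_of_frequently_atTop (hcon.and_eventually hprob)
  have hψp : ∀ n, IsProbabilityMeasure (m (ψ n)) := fun n => (hψb n).2
  choose C hCmin hCfar using fun n => not_subset.1 (hψb n).1
  -- This extraction comes before stability is used: the hit-or-avoid dichotomy passes to any `φ`
  -- tending to infinity, which is all that stability provides.
  obtain ⟨a, σ, hσ, ha⟩ := exists_subseq_eventually_iff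
    fun n i => (b i ∩ (C n : Set E)).Nonempty
  obtain ⟨φ, hφ, hlim⟩ := h𝓕.exists_lim_mem (fun n => (C (σ n) : Set E)) fun n => (C (σ n)).2
  have hto : Tendsto (fun k => ψ (σ k)) atTop atTop :=
    hψ.tendsto_atTop.comp hσ.tendsto_atTop
  set A : 𝓕 := ⟨setLim fun k => (C (σ (φ k)) : Set E), hlim⟩ with hA
  have hmass : 1 - α ≤ μ.real (A : Set E) :=
    le_measureReal_setLim (m := fun k => m (ψ (σ k))) (B := fun k => (C (σ k) : Set E)) hb
      (fun s => (hm s).comp hto) (fun k => h𝓕.isClosed _ (C (σ k)).2)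
      (fun k => (hCmin (σ k)).1) ha hφ (h𝓕.isClosed _ hlim)
  have hle : ∀ j, limsup (fun k => τ (C (σ (φ k)))) atTop ≤ τ (D j) := fun j => by
    refine limsup_le_of_le (by isBoundedDefault) ?_
    -- The strict inequality in `hD` is what survives passing from `μ` to `m n`.
    have h1 : ∀ᶠ n in atTop, 1 - α ≤ (m n).real (D j : Set E) :=
      ((hmD j).eventually (lt_mem_nhds (hD j))).mono fun n h => h.le
    filter_upwards [(hto.comp hφ).eventually h1] with k hk
    exact (hCmin (σ (φ k))).2 _ hk
  have hup := hDτ _ hle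
  have hlow : τ A ≤ liminf (fun k => τ (C (σ (φ k)))) atTop := H3 (fun k => C (σ (φ k))) hlim
  have hAτ : τ A ≤ minSize τ μ α := (hlow.trans (liminf_le_limsup)).trans hup
  have hAmin : A ∈ minimizers τ μ α := ⟨hmass, fun B hB => hAτ.trans (minSize_le hB)⟩
  have hconv : Tendsto (fun k => τ (C (σ (φ k)))) atTop (𝓝 (τ A)) :=
    tendsto_of_le_liminf_of_limsup_le hlow (hup.trans (minSize_le hmass))
  have hdist := H5 (fun k => C (σ (φ k))) hlim (hAτ.trans_lt hfin) hconv
  obtain ⟨k, hk⟩ := (hdist.eventually (gt_mem_nhds (ENNReal.ofReal_pos.2 hε))).exists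
  exact hCfar (σ (φ k)) ((Metric.infEDist_le_edist_of_mem hAmin).trans_lt hk)

end Deterministic

/-! ### The pointwise ergodic theorem for bounded functions -/

section Birkhoff

variable {α : Type*} {T : α → α} {g : α → ℝ}

/-- The running maximum `max (0, S₁, …, S_N)` of the Birkhoff sums of `g`. -/
def birkhoffMax (T : α → α) (g : α → ℝ) : ℕ → α → ℝ
  | 0, _ => 0
  | N + 1, x => max 0 (g x + birkhoffMax T g N (T x))

lemma birkhoffMax_nonneg (N : ℕ) (x : α) : 0 ≤ birkhoffMax T g N x := by
  cases N with
  | zero => exact le_rfl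
  | succ N => exact le_max_left _ _

lemma birkhoffMax_le_succ (N : ℕ) (x : α) : birkhoffMax T g N x ≤ birkhoffMax T g (N + 1) x := by
  induction N generalizing x with
  | zero => exact birkhoffMax_nonneg _ _
  | succ N ih => exact max_le_max le_rfl (add_le_add_right (ih (T x)) _)

lemma birkhoffSum_le_birkhoffMax (N : ℕ) (x : α) :
    birkhoffSum T g N x ≤ birkhoffMax T g N x := by
  induction N generalizing x with
  | zero => simp [birkhoffMax]
  | succ N ih =>
    rw [birkhoffSum_succ']
    exact (add_le_add_right (ih (T x)) _).trans (le_max_right _ _)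

variable [MeasurableSpace α] {μ : Measure α}

lemma measurable_birkhoffMax (hT : Measurable T) (hg : Measurable g) (N : ℕ) :
    Measurable (birkhoffMax T g N) := by
  induction N with
  | zero => exact measurable_const
  | succ N ih => exact measurable_const.max (hg.add (ih.comp hT))

lemma integrable_birkhoffMax (hT : MeasurePreserving T μ μ) (hg : Integrable g μ) (N : ℕ) :
    Integrable (birkhoffMax T g N) μ := by
  induction N with
  | zero => exact integrable_zero _ _ _
  | succ N ih => exact (integrable_zero α ℝ μ).sup (hg.add (hT.integrable_comp_of_integrable ih))

/-- The maximal ergodic inequality. -/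
lemma setIntegral_birkhoffMax_pos_nonneg (hT : MeasurePreserving T μ μ) (hgm : Measurable g)
    (hg : Integrable g μ) (N : ℕ) : 0 ≤ ∫ x in {x | 0 < birkhoffMax T g N x}, g x ∂μ := by
  cases N with
  | zero => simp [birkhoffMax]
  | succ N =>
    have hM := integrable_birkhoffMax hT hg
    have hmeas : MeasurableSet {x | 0 < birkhoffMax T g (N + 1) x} :=
      measurableSet_lt measurable_const (measurable_birkhoffMax hT.measurable hgm _)
    have hcomp : ∫ x, birkhoffMax T g N (T x) ∂μ = ∫ x, birkhoffMax T g N x ∂μ := by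
      have h := integral_map (μ := μ) hT.measurable.aemeasurable (f := birkhoffMax T g N)
        (measurable_birkhoffMax hT.measurable hgm N).aestronglyMeasurable
      rw [hT.map_eq] at h
      exact h.symm
    rw [← integral_indicator hmeas]
    -- Write `M N` for the running maximum. Where `M (N+1) > 0`, the recursion gives `g = M (N+1) -
    -- M N ∘ T`; elsewhere that difference is nonpositive. By invariance its integral is that of `M
    -- (N+1) - M N`, which is nonnegative.
    calc (0 : ℝ) ≤ ∫ x, birkhoffMax T g (N + 1) x ∂μ - ∫ x, birkhoffMax T g N x ∂μ :=
          sub_nonneg.2 (integral_mono (hM N) (hM (N + 1)) fun x => birkhoffMax_le_succ N x)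
      _ = ∫ x, (birkhoffMax T g (N + 1) x - birkhoffMax T g N (T x)) ∂μ := by
          rw [← hcomp]
          exact (integral_sub (hM _) (hT.integrable_comp_of_integrable (hM N))).symm
      _ ≤ _ := by
          refine integral_mono ((hM _).sub (hT.integrable_comp_of_integrable (hM N)))
            (hg.indicator hmeas) fun x => ?_
          by_cases hx : 0 < birkhoffMax T g (N + 1) x
          · rw [indicator_of_mem (by exact hx)]
            have : birkhoffMax T g (N + 1) x = g x + birkhoffMax T g N (T x) :=
              max_eq_right (not_lt.1 fun h => hx.ne' (max_eq_left h.le))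
            simp only [this]
            linarith
          · rw [indicator_of_notMem (by exact hx)]
            have := birkhoffMax_nonneg (T := T) (g := g) N (T x)
            simp only
            linarith [not_lt.1 hx]

/-- The sets in the maximal inequality increase with `N` to a set of full measure, so the inequality
passes to the whole space. -/
lemma integral_nonneg_of_exists_birkhoffSum_pos (hT : MeasurePreserving T μ μ)
    (hgm : Measurable g) (hg : Integrable g μ) (h : ∀ᵐ x ∂μ, ∃ n, 0 < birkhoffSum T g n x) :
    0 ≤ ∫ x, g x ∂μ := by
  have hmono : Monotone fun N => {x | 0 < birkhoffMax T g N x} :=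
    monotone_nat_of_le_succ fun N x hx => lt_of_lt_of_le hx (birkhoffMax_le_succ N x)
  have hlim := tendsto_setIntegral_of_monotone (μ := μ) (f := g)
    (fun N => measurableSet_lt measurable_const (measurable_birkhoffMax hT.measurable hgm N))
    hmono hg.integrableOn
  have hU : (⋃ N, {x | 0 < birkhoffMax T g N x}) =ᵐ[μ] univ :=
    eventuallyEq_univ.2 (h.mono fun x ⟨n, hn⟩ =>
      mem_iUnion.2 ⟨n, hn.trans_le (birkhoffSum_le_birkhoffMax n x)⟩)
  rw [setIntegral_congr_set hU, setIntegral_univ] at hlim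
  exact ge_of_tendsto' hlim (setIntegral_birkhoffMax_pos_nonneg hT hgm hg)

variable [IsProbabilityMeasure μ]

/-- The points where the averages exceed `b` infinitely often by a fixed margin form an invariant
set. Were it of full measure, some Birkhoff sum of `g - b` would be positive almost everywhere,
forcing the mean of `g` to be at least `b`. -/
lemma ae_eventually_birkhoffAverage_le (hT : Ergodic T μ) (hgm : Measurable g) {K : ℝ}
    (hK : ∀ x, ‖g x‖ ≤ K) {b : ℝ} (hb : ∫ x, g x ∂μ < b) :
    ∀ᵐ x ∂μ, ∀ k : ℕ, ∀ᶠ n in atTop, birkhoffAverage ℝ T g n x ≤ b + 1 / ((k : ℝ) + 1) := by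
  have hgi : Integrable g μ := Integrable.of_bound hgm.aestronglyMeasurable K (ae_of_all _ hK)
  let A : Set α := {x | ∃ k : ℕ, ∃ᶠ n in atTop, b + 1 / ((k : ℝ) + 1) < birkhoffAverage ℝ T g n x}
  have hAm : MeasurableSet A := by
    have : A = ⋃ k : ℕ, ⋂ N : ℕ, ⋃ n : ℕ, ⋃ _ : N ≤ n,
        {x | b + 1 / ((k : ℝ) + 1) < birkhoffAverage ℝ T g n x} := by
      ext x
      simp [A, frequently_atTop]
    rw [this]
    refine .iUnion fun k => .iInter fun N => .iUnion fun n => .iUnion fun _ =>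
      measurableSet_lt measurable_const ?_
    have hS : Measurable fun x => ∑ i ∈ Finset.range n, g (T^[i] x) :=
      Finset.measurable_fun_sum _ fun i _ => hgm.comp (hT.measurable.iterate i)
    exact hS.const_smul (n : ℝ)⁻¹
  have hstep : ∀ x y, Tendsto (fun n => birkhoffAverage ℝ T g n x - birkhoffAverage ℝ T g n y)
      atTop (𝓝 0) → y ∈ A → x ∈ A := by
    rintro x y hxy ⟨k, hk⟩
    -- A vanishing perturbation of the averages is absorbed by the smaller margin of index `k + 1`;
    -- this makes `A` exactly invariant, not merely up to a null set.
    refine ⟨k + 1, ?_⟩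
    have hpos : 0 < 1 / ((k : ℝ) + 1) - 1 / (((k + 1 : ℕ) : ℝ) + 1) := by
      rw [sub_pos]
      exact one_div_lt_one_div_of_lt (by positivity) (by push_cast; linarith)
    refine (hk.and_eventually (hxy.eventually (lt_mem_nhds (neg_lt_zero.2 hpos)))).mono ?_
    rintro n ⟨h1, h2⟩
    linarith
  have hbd : Bornology.IsBounded (range g) :=
    isBounded_iff_forall_norm_le.2 ⟨K, by rintro _ ⟨x, rfl⟩; exact hK x⟩
  have hinv : T ⁻¹' A = A := by
    ext x
    have h1 := tendsto_birkhoffAverage_apply_sub_birkhoffAverage' ℝ hbd T x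
    refine ⟨hstep x (T x) ?_, hstep (T x) x h1⟩
    simpa using h1.neg
  rcases hT.toPreErgodic.ae_mem_or_ae_notMem hAm hinv with h | h
  · exfalso
    have hpos : 0 ≤ ∫ x, (g x - b) ∂μ := by
      refine integral_nonneg_of_exists_birkhoffSum_pos hT.toMeasurePreserving
        (hgm.sub_const b) (hgi.sub (integrable_const b)) ?_
      filter_upwards [h] with x ⟨k, hk⟩
      obtain ⟨n, hn, hn0⟩ := (hk.and_eventually (eventually_gt_atTop 0)).exists
      refine ⟨n, ?_⟩
      have hn0' : (0 : ℝ) < n := by exact_mod_cast hn0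
      have h2 : b < (n : ℝ)⁻¹ * birkhoffSum T g n x := by
        have : 0 < 1 / ((k : ℝ) + 1) := by positivity
        rw [birkhoffAverage, smul_eq_mul] at hn
        linarith
      rw [inv_mul_eq_div, lt_div_iff₀ hn0'] at h2
      have h3 : birkhoffSum T (fun x => g x - b) n x = birkhoffSum T g n x - n * b := by
        simp [birkhoffSum]
      rw [h3]
      linarith
    rw [integral_sub hgi (integrable_const b)] at hpos
    simp at hpos
    linarith
  · filter_upwards [h] with x hx k
    by_contra hcon
    exact hx ⟨k, (not_eventually.1 hcon).mono fun n hn => not_le.1 hn⟩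

/-- The pointwise ergodic theorem for bounded functions. -/
theorem ae_tendsto_birkhoffAverage (hT : Ergodic T μ) (hgm : Measurable g) {K : ℝ}
    (hK : ∀ x, ‖g x‖ ≤ K) :
    ∀ᵐ x ∂μ, Tendsto (fun n => birkhoffAverage ℝ T g n x) atTop (𝓝 (∫ x, g x ∂μ)) := by
  have hup : ∀ {f : α → ℝ}, Measurable f → (∀ x, ‖f x‖ ≤ K) →
      ∀ᵐ x ∂μ, ∀ δ > 0, ∀ᶠ n in atTop, birkhoffAverage ℝ T f n x < ∫ x, f x ∂μ + δ := by
    intro f hf hfK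
    have h := fun j : ℕ => ae_eventually_birkhoffAverage_le hT hf hfK
      (b := ∫ x, f x ∂μ + 1 / ((j : ℝ) + 1)) (lt_add_of_pos_right _ (by positivity))
    filter_upwards [ae_all_iff.2 h] with x hx δ hδ
    -- The margin `1 / (j + 1)` is spent twice: once in `b`, once in the bound for the averages.
    obtain ⟨j, hj⟩ := exists_nat_one_div_lt (half_pos hδ)
    filter_upwards [hx j j] with n hn
    linarith
  filter_upwards [hup hgm hK, hup hgm.neg (fun x => by simpa using hK x)] with x h1 h2
  refine Metric.tendsto_atTop'.2 fun δ hδ => ?_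
  obtain ⟨N, hN⟩ := eventually_atTop.1 ((h1 δ hδ).and (h2 δ hδ))
  refine ⟨N, fun n hn => ?_⟩
  obtain ⟨h3, h4⟩ := hN n hn.le
  have h5 : birkhoffAverage ℝ T (-g) n x = -birkhoffAverage ℝ T g n x := by
    rw [birkhoffAverage_neg]; rfl
  rw [h5] at h4
  simp only [Pi.neg_apply, integral_neg] at h4
  rw [Real.dist_eq, abs_lt]
  constructor <;> linarith

end Birkhoff

/-! ### Markov laws on path space -/

section PathSpace

variable {E : Type*} [MeasurableSpace E]

variable (E) in
/-- The `σ`-algebra on sequences generated by the coordinates up to time `n`. -/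
@[reducible] def pastAlg (n : ℕ) : MeasurableSpace (ℕ → E) :=
  ⨆ (i : ℕ) (_ : i ≤ n), MeasurableSpace.comap (fun x : ℕ → E => x i) inferInstance

lemma comap_eval_le_pastAlg {i n : ℕ} (h : i ≤ n) :
    MeasurableSpace.comap (fun x : ℕ → E => x i) inferInstance ≤ pastAlg E n :=
  le_iSup₂_of_le i h le_rfl

lemma measurable_eval_pastAlg {i n : ℕ} (h : i ≤ n) :
    Measurable[pastAlg E n] (fun x : ℕ → E => x i) :=
  measurable_iff_comap_le.2 (comap_eval_le_pastAlg h)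

lemma pastAlg_le (n : ℕ) : pastAlg E n ≤ MeasurableSpace.pi :=
  iSup₂_le fun i _ => (measurable_pi_apply i).comap_le

lemma pastAlg_mono : Monotone (pastAlg E) := fun _ _ h =>
  iSup₂_le fun _ hi => comap_eval_le_pastAlg (hi.trans h)

lemma pastAlg_zero :
    pastAlg E 0 = MeasurableSpace.comap (fun x : ℕ → E => x 0) inferInstance :=
  le_antisymm (iSup₂_le fun i hi => by rw [Nat.le_zero.1 hi]) (comap_eval_le_pastAlg le_rfl)

lemma pastAlg_succ_le (n : ℕ) : pastAlg E (n + 1) ≤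
    pastAlg E n ⊔ MeasurableSpace.comap (fun x : ℕ → E => x (n + 1)) inferInstance := by
  refine iSup₂_le fun i hi => ?_
  rcases Nat.le_succ_iff.1 hi with h | rfl
  · exact le_sup_of_le_left (comap_eval_le_pastAlg h)
  · exact le_sup_right

lemma iSup_pastAlg : (⨆ n, pastAlg E n) = MeasurableSpace.pi :=
  le_antisymm (iSup_le pastAlg_le) (iSup_le fun i => le_iSup_of_le i (comap_eval_le_pastAlg le_rfl))

lemma exists_eq_preimage_frestrictLe {n : ℕ} {C : Set (ℕ → E)} (hC : MeasurableSet[pastAlg E n] C) :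
    ∃ A, MeasurableSet A ∧ Preorder.frestrictLe (π := fun _ : ℕ => E) n ⁻¹' A = C := by
  have : pastAlg E n ≤
      MeasurableSpace.comap (Preorder.frestrictLe (π := fun _ : ℕ => E) n) inferInstance := by
    refine iSup₂_le fun i hi => ?_
    rintro _ ⟨t, ht, rfl⟩
    exact ⟨(fun y : (∀ j : Finset.Iic n, E) => y ⟨i, Finset.mem_Iic.2 hi⟩) ⁻¹' t,
      measurable_pi_apply _ ht, rfl⟩
  exact this C hC

/-- Finite measures on sequences that agree on all events of the finite past are equal. -/
lemma measure_ext_of_pastAlg {ν ν' : Measure (ℕ → E)} [IsFiniteMeasure ν]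
    (h : ∀ n C, MeasurableSet[pastAlg E n] C → ν C = ν' C) : ν = ν' := by
  refine ext_of_generate_finite (⋃ n, {s | MeasurableSet[pastAlg E n] s})
    (((MeasurableSpace.generateFrom_iUnion_measurableSet (pastAlg E)).trans iSup_pastAlg).symm)
    (isPiSystem_iUnion_of_monotone _
      (fun n => @MeasurableSpace.isPiSystem_measurableSet _ (pastAlg E n))
      fun _ _ hmn s hs => pastAlg_mono hmn s hs) ?_ (h 0 _ (@MeasurableSet.univ _ (pastAlg E 0)))
  intro s hs
  obtain ⟨n, hn⟩ := mem_iUnion.1 hs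
  exact h n s hn

/-- The time shift on sequences. -/
def shift (m : ℕ) (x : ℕ → E) : ℕ → E := fun i => x (i + m)

lemma measurable_shift (m : ℕ) : Measurable (shift (E := E) m) :=
  measurable_pi_lambda _ fun i => measurable_pi_apply (i + m)

lemma measurableSet_shift_preimage {m n : ℕ} {D : Set (ℕ → E)} (hD : MeasurableSet[pastAlg E n] D) :
    MeasurableSet[pastAlg E (n + m)] (shift m ⁻¹' D) := by
  have : pastAlg E n ≤ (pastAlg E (n + m)).map (shift m) := by
    refine iSup₂_le fun i hi => ?_
    rintro _ ⟨t, ht, rfl⟩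
    exact measurable_eval_pastAlg (Nat.add_le_add_right hi m) ht
  exact this D hD

omit [MeasurableSpace E] in
lemma shift_one_iterate (m : ℕ) (x : ℕ → E) : (shift 1)^[m] x = shift m x := by
  induction m generalizing x with
  | zero => rfl
  | succ m ih =>
    rw [Function.iterate_succ_apply, ih]
    funext i
    exact congrArg x (by ring)

/-- `ν` is, up to normalization, the law of a Markov chain with transition kernel `κ`. -/
def IsMarkovLaw (κ : Kernel E E) (ν : Measure (ℕ → E)) : Prop :=
  ∀ (n : ℕ) (C : Set (ℕ → E)), MeasurableSet[pastAlg E n] C → ∀ B : Set E, MeasurableSet B →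
    ν (C ∩ (fun x => x (n + 1)) ⁻¹' B) = ∫⁻ x in C, κ (x n) B ∂ν

variable {κ : Kernel E E}

lemma setLIntegral_congr_of_pastAlg {ν ν' : Measure (ℕ → E)} {n : ℕ}
    (h : ∀ C, MeasurableSet[pastAlg E n] C → ν C = ν' C) {C : Set (ℕ → E)}
    (hC : MeasurableSet[pastAlg E n] C) {f : E → ℝ≥0∞} (hf : Measurable f) :
    ∫⁻ x in C, f (x n) ∂ν = ∫⁻ x in C, f (x n) ∂ν' := by
  have hfm : Measurable[pastAlg E n] (fun x : ℕ → E => f (x n)) :=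
    hf.comp (measurable_eval_pastAlg le_rfl)
  have htrim : ν.trim (pastAlg_le n) = ν'.trim (pastAlg_le n) :=
    @Measure.ext _ (pastAlg E n) _ _ fun s hs => by
      rw [trim_measurableSet_eq _ hs, trim_measurableSet_eq _ hs, h s hs]
  rw [← lintegral_trim (μ := ν.restrict C) (pastAlg_le n) hfm,
    ← lintegral_trim (μ := ν'.restrict C) (pastAlg_le n) hfm,
    ← restrict_trim _ _ hC, ← restrict_trim _ _ hC, htrim]

/-- A Markov law is determined by the transition kernel and the initial law. -/
lemma IsMarkovLaw.ext {ν ν' : Measure (ℕ → E)} [IsFiniteMeasure ν]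
    (h : IsMarkovLaw κ ν) (h' : IsMarkovLaw κ ν')
    (h0 : ν.map (fun x => x 0) = ν'.map (fun x => x 0)) : ν = ν' := by
  refine measure_ext_of_pastAlg fun n => ?_
  induction n with
  | zero =>
    rw [pastAlg_zero]
    rintro _ ⟨t, ht, rfl⟩
    rw [← Measure.map_apply (measurable_pi_apply 0) ht, h0,
      Measure.map_apply (measurable_pi_apply 0) ht]
  | succ n ih =>
    -- Events of the past intersected with a condition at time `n + 1` form a π-system generating
    -- the next σ-algebra, and the Markov identity computes their mass from the past alone.
    let S : Set (Set (ℕ → E)) := {s | ∃ C B, MeasurableSet[pastAlg E n] C ∧ MeasurableSet B ∧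
      s = C ∩ (fun x => x (n + 1)) ⁻¹' B}
    have hSle : ∀ s ∈ S, MeasurableSet s := by
      rintro _ ⟨C, B, hC, hB, rfl⟩
      exact (pastAlg_le n C hC).inter (measurable_pi_apply (n + 1) hB)
    have hSpi : IsPiSystem S := by
      rintro _ ⟨C, B, hC, hB, rfl⟩ _ ⟨C', B', hC', hB', rfl⟩ _
      refine ⟨C ∩ C', B ∩ B', @MeasurableSet.inter _ (pastAlg E n) _ _ hC hC', hB.inter hB', ?_⟩
      rw [preimage_inter, inter_inter_inter_comm]
    have hgen : pastAlg E (n + 1) ≤ MeasurableSpace.generateFrom S := by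
      refine (pastAlg_succ_le n).trans (sup_le (fun C hC => ?_) ?_)
      · exact MeasurableSpace.measurableSet_generateFrom ⟨C, univ, hC, .univ, by simp⟩
      · rintro _ ⟨B, hB, rfl⟩
        exact MeasurableSpace.measurableSet_generateFrom
          ⟨univ, B, @MeasurableSet.univ _ (pastAlg E n), hB, by simp⟩
    intro C hC
    have hle : MeasurableSpace.generateFrom S ≤ MeasurableSpace.pi :=
      MeasurableSpace.generateFrom_le hSle
    have hS : ∀ s ∈ S, ν s = ν' s := by
      rintro _ ⟨C, B, hC, hB, rfl⟩
      rw [h n C hC B hB, h' n C hC B hB]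
      exact setLIntegral_congr_of_pastAlg ih hC (κ.measurable_coe hB)
    exact ext_on_measurableSpace_of_generate_finite MeasurableSpace.pi S hS hle rfl hSpi
      (ih _ (@MeasurableSet.univ _ (pastAlg E n))) (hgen C hC)

/-- The Markov property: conditionally on an event of the past, the shifted sequence still has a
Markov law. -/
lemma IsMarkovLaw.map_shift_restrict {ν : Measure (ℕ → E)} (h : IsMarkovLaw κ ν) {m : ℕ}
    {C : Set (ℕ → E)} (hC : MeasurableSet[pastAlg E m] C) :
    IsMarkovLaw κ ((ν.restrict C).map (shift m)) := by
  intro n D hD B hB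
  have hDm := pastAlg_le n D hD
  have hCD : MeasurableSet[pastAlg E (n + m)] (shift m ⁻¹' D ∩ C) :=
    @MeasurableSet.inter _ (pastAlg E (n + m)) _ _ (measurableSet_shift_preimage hD)
      (pastAlg_mono (Nat.le_add_left m n) C hC)
  have hf : Measurable fun x : ℕ → E => κ (x n) B :=
    (κ.measurable_coe hB).comp (measurable_pi_apply n)
  rw [Measure.map_apply (measurable_shift m) (hDm.inter (measurable_pi_apply (n + 1) hB)),
    Measure.restrict_apply (measurable_shift m (hDm.inter (measurable_pi_apply (n + 1) hB))),
    setLIntegral_map hDm hf (measurable_shift m),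
    Measure.restrict_restrict (measurable_shift m hDm)]
  have := h (n + m) _ hCD B hB
  simp only [shift] at this ⊢
  rw [← this]
  congr 1
  ext x
  simp only [mem_inter_iff, mem_preimage, shift, show n + 1 + m = n + m + 1 by ring]
  tauto

variable [IsMarkovKernel κ]

/-- The transition kernel of a Markov chain, seen as depending on the whole past. -/
def historyKernel (κ : Kernel E E) (n : ℕ) : Kernel (∀ _ : Finset.Iic n, E) E :=
  κ.comap (fun y => y ⟨n, Finset.mem_Iic.2 le_rfl⟩) (measurable_pi_apply _)

instance (n : ℕ) : IsMarkovKernel (historyKernel κ n) := by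
  unfold historyKernel; infer_instance

/-- The law of the Markov chain with transition kernel `κ`, as a function of its starting point. -/
def pathKernel (κ : Kernel E E) [IsMarkovKernel κ] : Kernel E (ℕ → E) :=
  (Kernel.traj (X := fun _ => E) (historyKernel κ) 0).comap (fun x _ => x)
    (measurable_pi_lambda _ fun _ => measurable_id)

instance : IsMarkovKernel (pathKernel κ) := by
  unfold pathKernel; infer_instance

/-- This is the one-step identity of the Ionescu-Tulcea construction, evaluated on rectangles. -/
lemma isMarkovLaw_pathKernel (x : E) : IsMarkovLaw κ (pathKernel κ x) := by
  intro n C hC B hB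
  obtain ⟨A, hA, rfl⟩ := exists_eq_preimage_frestrictLe hC
  have hr : Measurable (Preorder.frestrictLe (π := fun _ : ℕ => E) n) :=
    Preorder.measurable_frestrictLe n
  have h := Kernel.partialTraj_compProd_eq_map_traj (X := fun _ => E) (κ := historyKernel κ)
    (Nat.zero_le n) (x₀ := fun _ => x)
  rw [← Kernel.traj_map_frestrictLe_apply] at h
  have h2 := congrArg (fun ρ => ρ (A ×ˢ B)) h
  rw [Measure.compProd_apply_prod hA hB, setLIntegral_map hA
    ((historyKernel κ n).measurable_coe hB) hr, Measure.map_apply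
    (hr.prodMk (measurable_pi_apply (n + 1))) (hA.prod hB)] at h2
  exact h2.symm

lemma pathKernel_map_zero (x : E) : (pathKernel κ x).map (fun y => y 0) = Measure.dirac x := by
  have h := Kernel.traj_map_frestrictLe_apply (X := fun _ => E) (κ := historyKernel κ) 0 0
    (fun _ => x)
  rw [Kernel.partialTraj_self, Kernel.id_apply] at h
  have h2 := congrArg (fun ρ => ρ.map (fun y : (∀ _ : Finset.Iic 0, E) => y ⟨0, by simp⟩)) h
  have he : Measurable fun y : (∀ _ : Finset.Iic 0, E) => y ⟨0, by simp⟩ := measurable_pi_apply _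
  rw [Measure.map_map he (Preorder.measurable_frestrictLe 0)] at h2
  exact h2.trans (Measure.map_dirac' he (fun _ => x))

lemma isMarkovLaw_comp (ρ : Measure E) : IsMarkovLaw κ (pathKernel κ ∘ₘ ρ) := by
  intro n C hC B hB
  have hCm := pastAlg_le n C hC
  have hf : Measurable fun y : ℕ → E => κ (y n) B :=
    (κ.measurable_coe hB).comp (measurable_pi_apply n)
  rw [Measure.bind_apply (hCm.inter (measurable_pi_apply (n + 1) hB)) (Kernel.aemeasurable _),
    ← lintegral_indicator hCm, Measure.lintegral_bind (Kernel.aemeasurable _)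
      (hf.indicator hCm).aemeasurable]
  refine lintegral_congr fun x => ?_
  rw [lintegral_indicator hCm]
  exact isMarkovLaw_pathKernel x n C hC B hB

lemma comp_map_zero (ρ : Measure E) : (pathKernel κ ∘ₘ ρ).map (fun y => y 0) = ρ := by
  ext s hs
  rw [Measure.map_apply (measurable_pi_apply 0) hs,
    Measure.bind_apply (measurable_pi_apply 0 hs) (Kernel.aemeasurable _),
    ← lintegral_indicator_one hs]
  refine lintegral_congr fun x => ?_
  rw [← Measure.map_apply (measurable_pi_apply 0) hs, pathKernel_map_zero,
    Measure.dirac_apply' _ hs]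

lemma IsMarkovLaw.eq_comp {ν : Measure (ℕ → E)} [IsFiniteMeasure ν] (h : IsMarkovLaw κ ν) :
    ν = pathKernel κ ∘ₘ ν.map (fun y => y 0) :=
  h.ext (isMarkovLaw_comp _) (comp_map_zero _).symm

/-- The Markov property for arbitrary events of the future: the law restricted to `C` and shifted is
again Markov, hence the mixture of path laws over its own initial law. Markov laws are left
unnormalized so that this applies to a restriction. -/
lemma IsMarkovLaw.measure_inter_shift_preimage {ν : Measure (ℕ → E)} [IsFiniteMeasure ν]
    (h : IsMarkovLaw κ ν) {m : ℕ} {C : Set (ℕ → E)} (hC : MeasurableSet[pastAlg E m] C)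
    {A : Set (ℕ → E)} (hA : MeasurableSet A) :
    ν (C ∩ shift m ⁻¹' A) = ∫⁻ x in C, pathKernel κ (x m) A ∂ν := by
  have h1 := congrArg (fun ρ => ρ A) (h.map_shift_restrict hC).eq_comp
  rw [Measure.map_apply (measurable_shift m) hA,
    Measure.restrict_apply (measurable_shift m hA), Measure.bind_apply hA (Kernel.aemeasurable _),
    Measure.map_map (measurable_pi_apply 0) (measurable_shift m),
    lintegral_map ((pathKernel κ).measurable_coe hA)
      ((measurable_pi_apply 0).comp (measurable_shift m))] at h1
  rw [inter_comm, h1]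
  simp [shift]

omit [IsMarkovKernel κ] in
lemma IsMarkovLaw.map_eval {ν : Measure (ℕ → E)} (h : IsMarkovLaw κ ν) (n : ℕ) :
    ν.map (fun x => x (n + 1)) = κ ∘ₘ ν.map (fun x => x n) := by
  ext B hB
  have := h n univ (@MeasurableSet.univ _ (pastAlg E n)) B hB
  rw [Measure.map_apply (measurable_pi_apply _) hB, Measure.bind_apply hB (Kernel.aemeasurable _),
    lintegral_map (κ.measurable_coe hB) (measurable_pi_apply _)]
  simpa using this

lemma pathKernel_map_eval (x : E) (n : ℕ) : (pathKernel κ x).map (fun y => y n) = (κ ^ n) x := by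
  induction n with
  | zero => rw [pathKernel_map_zero, pow_zero]; rfl
  | succ n ih =>
    rw [(isMarkovLaw_pathKernel x).map_eval, ih, pow_succ']
    rfl

/-- Started from an invariant law, a Markov chain is stationary. -/
lemma measurePreserving_shift {μ : Measure E} [IsFiniteMeasure μ] (hμ : κ.Invariant μ) :
    MeasurePreserving (shift 1) (pathKernel κ ∘ₘ μ) (pathKernel κ ∘ₘ μ) := by
  refine ⟨measurable_shift 1, ?_⟩
  have h1 := (isMarkovLaw_comp (κ := κ) μ).map_shift_restrict (m := 1)
    (@MeasurableSet.univ _ (pastAlg E 1))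
  rw [Measure.restrict_univ] at h1
  refine h1.ext (isMarkovLaw_comp μ) ?_
  rw [Measure.map_map (measurable_pi_apply 0) (measurable_shift 1)]
  have h2 := (isMarkovLaw_comp (κ := κ) μ).map_eval 0
  rw [comp_map_zero, hμ.def] at h2
  rw [comp_map_zero]
  exact h2

end PathSpace

/-! ### Harmonic functions and ergodicity of the stationary chain -/

section Ergodicity

variable {E : Type*} [MeasurableSpace E] {κ : Kernel E E} [IsMarkovKernel κ]
  {μ : Measure E} [IsProbabilityMeasure μ]

omit [IsMarkovKernel κ] [IsProbabilityMeasure μ] in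
lemma ae_ae_of_invariant (hμ : κ.Invariant μ) {p : E → Prop} (h : ∀ᵐ x ∂μ, p x) :
    ∀ᵐ x ∂μ, ∀ᵐ y ∂(κ x), p y := by
  rw [← hμ.def] at h
  exact Measure.ae_ae_of_ae_comp h

/-- A bounded harmonic function is almost surely preserved by one step of the stationary chain. -/
lemma ae_ae_eq_of_harmonic (hμ : κ.Invariant μ) {f : E → ℝ} (hf : Measurable f) {K : ℝ}
    (hK : ∀ x, ‖f x‖ ≤ K) (hharm : ∀ x, ∫ y, f y ∂(κ x) = f x) :
    ∀ᵐ x ∂μ, ∀ᵐ y ∂(κ x), f y = f x := by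
  have hint : ∀ (ρ : Measure E) [IsFiniteMeasure ρ], Integrable f ρ := fun ρ _ =>
    Integrable.of_bound hf.aestronglyMeasurable K (ae_of_all _ hK)
  have hint2 : ∀ (ρ : Measure E) [IsFiniteMeasure ρ], Integrable (fun x => f x ^ 2) ρ :=
    fun ρ _ => Integrable.of_bound (hf.pow_const 2).aestronglyMeasurable (K ^ 2)
      (ae_of_all _ fun x => by
        rw [norm_pow]; exact pow_le_pow_left₀ (norm_nonneg _) (hK x) 2)
  -- Harmonicity makes `f x` the mean of `f` under `κ x`, so this is a conditional variance. Its
  -- `μ`-integral vanishes by invariance applied to `f ^ 2`.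
  have hvar : ∀ x, ∫ y, (f y - f x) ^ 2 ∂(κ x) = ∫ y, f y ^ 2 ∂(κ x) - f x ^ 2 := fun x => by
    have h1 : ∀ y, (f y - f x) ^ 2 = f y ^ 2 - 2 * f x * f y + f x ^ 2 := fun y => by ring
    simp_rw [h1]
    rw [integral_add (f := fun y => f y ^ 2 - 2 * f x * f y) (g := fun _ => f x ^ 2)
        ((hint2 _).sub ((hint _).const_mul _)) (integrable_const _),
      integral_sub (hint2 _) ((hint _).const_mul _), integral_const_mul, hharm]
    simp
    ring
  have hcomp : Integrable (fun x => ∫ y, f y ^ 2 ∂(κ x)) μ := by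
    refine Integrable.of_bound
      (hf.pow_const 2).stronglyMeasurable.integral_kernel.aestronglyMeasurable (K ^ 2)
      (ae_of_all _ fun x => ?_)
    have h := norm_integral_le_of_norm_le_const (μ := κ x) (f := fun y => f y ^ 2) (C := K ^ 2)
      (ae_of_all _ fun y => by rw [norm_pow]; exact pow_le_pow_left₀ (norm_nonneg _) (hK y) 2)
    simpa using h
  have hbind : ∫ x, (∫ y, f y ^ 2 ∂(κ x)) ∂μ = ∫ x, f x ^ 2 ∂μ := by
    have h := Kernel.integral_comp (η := κ) (κ := Kernel.const Unit μ) (a := ())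
      (f := fun y => f y ^ 2) (hint2 _)
    rw [← Measure.comp_eq_comp_const_apply, hμ.def, Kernel.const_apply] at h
    exact h.symm
  have hzero : ∫ x, (∫ y, (f y - f x) ^ 2 ∂(κ x)) ∂μ = 0 := by
    simp_rw [hvar]
    rw [integral_sub hcomp (hint2 μ), hbind, sub_self]
  have hae := (integral_eq_zero_iff_of_nonneg
    (fun x => integral_nonneg fun y => sq_nonneg (f y - f x))
    (by simp_rw [hvar]; exact hcomp.sub (hint2 μ))).1 hzero
  filter_upwards [hae] with x hx
  have hi : Integrable (fun y => (f y - f x) ^ 2) (κ x) := by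
    refine Integrable.of_bound ((hf.sub_const _).pow_const 2).aestronglyMeasurable ((K + K) ^ 2)
      (ae_of_all _ fun y => ?_)
    rw [norm_pow]
    exact pow_le_pow_left₀ (norm_nonneg _)
      ((norm_sub_le _ _).trans (add_le_add (hK y) (hK x))) 2
  have hx' := (integral_eq_zero_iff_of_nonneg (fun y => sq_nonneg (f y - f x)) hi).1 hx
  filter_upwards [hx'] with y hy
  exact sub_eq_zero.1 (pow_eq_zero_iff (two_ne_zero) |>.1 hy)

/-- Bounded harmonic functions are almost everywhere constant if invariant sets are trivial. -/
lemma exists_ae_eq_const_of_harmonic (hμ : κ.Invariant μ) (htriv : TrivialInvariantSets κ μ)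
    {f : E → ℝ} (hf : Measurable f) {K : ℝ} (hK : ∀ x, ‖f x‖ ≤ K)
    (hharm : ∀ x, ∫ y, f y ∂(κ x) = f x) : ∃ c, ∀ᵐ x ∂μ, f x = c := by
  -- Since a step preserves `f` almost surely, every preimage `f ⁻¹' U` is an invariant set;
  -- measurable subsets of the line separate points countably.
  refine exists_eventuallyEq_const_of_forall_separating (l := ae μ) (f := f)
    MeasurableSet fun U hU => ?_
  have hA : MeasurableSet (f ⁻¹' U) := hf hU
  have hinv : (fun x => κ x (f ⁻¹' U)) =ᵐ[μ] (f ⁻¹' U).indicator fun _ => 1 := by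
    filter_upwards [ae_ae_eq_of_harmonic hμ hf hK hharm] with x hx
    by_cases hxU : x ∈ f ⁻¹' U
    · rw [indicator_of_mem hxU, ← prob_compl_eq_zero_iff hA]
      change ∀ᵐ y ∂(κ x), y ∈ f ⁻¹' U
      filter_upwards [hx] with y hy
      rw [mem_preimage, hy]
      exact hxU
    · rw [indicator_of_notMem hxU, measure_eq_zero_iff_ae_notMem]
      filter_upwards [hx] with y hy
      rw [mem_preimage, hy]
      exact hxU
  rcases htriv _ hA hinv with h | h
  · exact Or.inr (measure_eq_zero_iff_ae_notMem.1 h)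
  · exact Or.inl ((prob_compl_eq_zero_iff hA).2 h)

/-- The stationary chain is ergodic for the shift if invariant sets are trivial. -/
lemma ergodic_shift (hμ : κ.Invariant μ) (htriv : TrivialInvariantSets κ μ) :
    Ergodic (shift 1) (pathKernel κ ∘ₘ μ) := by
  set ν := pathKernel κ ∘ₘ μ
  refine ⟨measurePreserving_shift hμ, ⟨fun A hA hinv => ?_⟩⟩
  have hsm : ∀ m, shift m ⁻¹' A = A := fun m => by
    have h : shift (E := E) m = (shift 1)^[m] := funext fun x => (shift_one_iterate m x).symm
    rw [h, preimage_iterate_eq]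
    exact Function.iterate_fixed hinv m
  let f : E → ℝ := fun x => (pathKernel κ x).real A
  have hf : Measurable f := ((pathKernel κ).measurable_coe hA).ennreal_toReal
  have hharm : ∀ x, ∫ y, f y ∂(κ x) = f x := fun x => by
    have hP := isMarkovLaw_pathKernel (κ := κ) x
    have h1 := hP.measure_inter_shift_preimage
      (m := 1) (@MeasurableSet.univ _ (pastAlg E 1)) hA
    have h2 := hP.map_eval 0
    rw [pathKernel_map_zero, Measure.dirac_bind κ.measurable] at h2
    rw [hsm, univ_inter, Measure.restrict_univ, ← lintegral_map (f := fun y => pathKernel κ y A)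
      ((pathKernel κ).measurable_coe hA) (measurable_pi_apply 1), h2] at h1
    simp only [f, Measure.real]
    rw [integral_toReal ((pathKernel κ).measurable_coe hA).aemeasurable
      (ae_of_all _ fun y => measure_lt_top _ _), h1]
  obtain ⟨c, hc⟩ := exists_ae_eq_const_of_harmonic hμ htriv hf (K := 1)
    (fun x => by simp only [f, Real.norm_eq_abs, abs_of_nonneg measureReal_nonneg]
                 exact measureReal_le_one) hharm
  have hc' : ∀ᵐ x ∂μ, pathKernel κ x A = ENNReal.ofReal c := hc.mono fun x hx => by
    rw [← hx]; simp [f, Measure.real]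
  have hmarg : ∀ m, ν.map (fun y => y m) = μ := fun m => by
    induction m with
    | zero => exact comp_map_zero μ
    | succ m ih => rw [(isMarkovLaw_comp μ).map_eval, ih, hμ.def]
  -- Given any past, the invariant event `A` has conditional probability `c`. Thus `A` is
  -- independent of every finite past, hence of itself, which gives the zero-one law.
  have hindep : ν.restrict A = ENNReal.ofReal c • ν := by
    refine measure_ext_of_pastAlg fun n C hC => ?_
    rw [Measure.restrict_apply (pastAlg_le n C hC)]
    have h1 := (isMarkovLaw_comp (κ := κ) μ).measure_inter_shift_preimage hC hA
    have h2 : ∀ᵐ y ∂ν, pathKernel κ (y n) A = ENNReal.ofReal c :=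
      ae_of_ae_map (measurable_pi_apply n).aemeasurable (by rw [hmarg n]; exact hc')
    rw [hsm, lintegral_congr_ae (ae_restrict_of_ae h2)] at h1
    rw [h1]
    simp
  have h1 : ν A = ENNReal.ofReal c := by
    have := congrArg (fun ρ => ρ univ) hindep
    simpa using this
  have h2 : ν A = ENNReal.ofReal c * ν A := by
    have := congrArg (fun ρ => ρ A) hindep
    simpa using this
  rw [eventuallyConst_set]
  by_cases h0 : ν A = 0
  · exact Or.inr (measure_eq_zero_iff_ae_notMem.1 h0)
  · left
    have : ν A = 1 := by
      rw [← h1] at h2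
      exact ((ENNReal.mul_eq_left h0 (measure_ne_top _ _)).1 h2.symm)
    exact (prob_compl_eq_zero_iff hA).2 this

end Ergodicity

/-! ### The law of large numbers for ergodic chains -/

section LawOfLargeNumbers

variable {E : Type*} [MeasurableSpace E] {κ : Kernel E E} [IsMarkovKernel κ]
  {μ : Measure E} [IsProbabilityMeasure μ]

/-- The sequences along which the empirical frequency of `U` converges to `μ(U)`. -/
def frequencySet (μ : Measure E) (U : Set E) : Set (ℕ → E) :=
  {x | Tendsto (fun n => birkhoffAverage ℝ (shift 1)
    (fun y : ℕ → E => U.indicator (fun _ => (1 : ℝ)) (y 0)) n x) atTop (𝓝 (μ.real U))}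

lemma measurable_indicator_eval {U : Set E} (hU : MeasurableSet U) :
    Measurable fun y : ℕ → E => U.indicator (fun _ => (1 : ℝ)) (y 0) :=
  (measurable_const.indicator hU).comp (measurable_pi_apply 0)

omit [MeasurableSpace E] in
lemma norm_indicator_eval_le (U : Set E) (y : ℕ → E) :
    ‖U.indicator (fun _ => (1 : ℝ)) (y 0)‖ ≤ 1 := by
  by_cases h : y 0 ∈ U <;> simp [h]

omit [IsProbabilityMeasure μ] in
lemma measurableSet_frequencySet {U : Set E} (hU : MeasurableSet U) :
    MeasurableSet (frequencySet μ U) := by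
  refine measurableSet_tendsto _ fun n => ?_
  have hS : Measurable fun x : ℕ → E => ∑ i ∈ Finset.range n,
      U.indicator (fun _ => (1 : ℝ)) ((shift 1)^[i] x 0) :=
    Finset.measurable_fun_sum _ fun i _ =>
      (measurable_indicator_eval hU).comp ((measurable_shift 1).iterate i)
  exact hS.const_smul (n : ℝ)⁻¹

omit [IsProbabilityMeasure μ] in
lemma shift_preimage_frequencySet (U : Set E) (m : ℕ) :
    shift m ⁻¹' frequencySet μ U = frequencySet μ U := by
  have h1 : shift 1 ⁻¹' frequencySet μ U = frequencySet μ U := by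
    ext x
    have hbd : Bornology.IsBounded
        (range fun y : ℕ → E => U.indicator (fun _ => (1 : ℝ)) (y 0)) :=
      isBounded_iff_forall_norm_le.2 ⟨1, by rintro _ ⟨y, rfl⟩; exact norm_indicator_eval_le U y⟩
    have h := tendsto_birkhoffAverage_apply_sub_birkhoffAverage' ℝ hbd (shift 1) x
    refine ⟨fun hx => ?_, fun hx => ?_⟩
    · simpa [frequencySet] using Tendsto.sub hx h
    · simpa [frequencySet] using Tendsto.add hx h
  have h : shift (E := E) m = (shift 1)^[m] := funext fun x => (shift_one_iterate m x).symm
  rw [h, preimage_iterate_eq]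
  exact Function.iterate_fixed h1 m

lemma measure_compl_frequencySet_comp (hμ : κ.Invariant μ) (htriv : TrivialInvariantSets κ μ)
    {U : Set E} (hU : MeasurableSet U) : ∀ᵐ x ∂μ, pathKernel κ x (frequencySet μ U)ᶜ = 0 := by
  have h := ae_tendsto_birkhoffAverage (ergodic_shift hμ htriv) (measurable_indicator_eval hU)
    (norm_indicator_eval_le U)
  have hint : ∫ y, U.indicator (fun _ => (1 : ℝ)) (y 0) ∂(pathKernel κ ∘ₘ μ) = μ.real U := by
    have h1 := integral_map (μ := pathKernel κ ∘ₘ μ) (measurable_pi_apply 0).aemeasurable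
      (f := U.indicator fun _ => (1 : ℝ))
      (measurable_const.indicator hU).aestronglyMeasurable
    rw [comp_map_zero, integral_indicator_const _ hU] at h1
    simpa using h1.symm
  rw [hint] at h
  exact Measure.ae_ae_of_ae_comp h

-- From a suitable point of an invariant set of positive mass the chain stays in it with probability
-- one at every positive time, and the limit in total variation forces that mass to be one. The
-- second ergodicity assumption can thus use the stationary theory.
omit [IsMarkovKernel κ] [IsProbabilityMeasure μ] in
lemma trivialInvariantSets_of_convergesInTotalVariation (hμ : κ.Invariant μ)
    (hTV : ConvergesInTotalVariation κ μ) : TrivialInvariantSets κ μ := by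
  intro A hA hinv
  have hn : ∀ n : ℕ, ∀ᵐ x ∂μ, (κ ^ (n + 1)) x A = A.indicator (fun _ => 1) x := fun n => by
    induction n with
    | zero => exact hinv.mono fun x hx => by simpa using hx
    | succ n ih =>
      filter_upwards [hinv, ae_ae_of_invariant hμ ih] with x hx hy
      rw [add_comm, Kernel.pow_add_apply_eq_lintegral _ _ _ _ hA, pow_one, lintegral_congr_ae hy,
        ← hx]
      exact lintegral_indicator_one hA
  by_cases h0 : μ A = 0
  · exact Or.inl h0
  right
  obtain ⟨x, hxA, hx⟩ := ((frequently_ae_mem_iff.2 h0).and_eventually (ae_all_iff.2 hn)).exists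
  have h1 : ENNReal.ofReal |1 - μ.real A| ≤ 0 := by
    refine ge_of_tendsto' ((tendsto_add_atTop_iff_nat 1).2 (hTV x)) fun n => ?_
    refine le_trans (le_of_eq ?_) (le_iSup₂ (f := fun (A : Set E) (_ : MeasurableSet A) =>
      ENNReal.ofReal |((κ ^ (n + 1)) x).real A - μ.real A|) A hA)
    rw [Measure.real, Measure.real, hx n, indicator_of_mem hxA]
    simp
  have h2 : μ.real A = 1 := by
    have := ENNReal.ofReal_eq_zero.1 (le_zero_iff.1 h1)
    linarith [abs_eq_zero.1 (le_antisymm this (abs_nonneg _))]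
  rw [← ENNReal.toReal_eq_one_iff]
  exact h2

/-- The law of large numbers from every starting point, under convergence in total variation. -/
lemma pathKernel_compl_frequencySet (hμ : κ.Invariant μ) (hTV : ConvergesInTotalVariation κ μ)
    {U : Set E} (hU : MeasurableSet U) (x : E) : pathKernel κ x (frequencySet μ U)ᶜ = 0 := by
  have hG := (measurableSet_frequencySet (μ := μ) hU).compl
  -- `N` collects the bad starting points and is `μ`-null. Shift invariance of the frequency event
  -- allows a restart at time `n`, so the failure probability from `x` is at most `(κ ^ n) x N`,
  -- which tends to `μ N = 0`.
  let N : Set E := {y | pathKernel κ y (frequencySet μ U)ᶜ ≠ 0}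
  have hN : MeasurableSet N :=
    (measurableSet_eq_fun ((pathKernel κ).measurable_coe hG) measurable_const).compl
  have hN0 : μ N = 0 := measure_eq_zero_iff_ae_notMem.2
    ((measure_compl_frequencySet_comp hμ
      (trivialInvariantSets_of_convergesInTotalVariation hμ hTV) hU).mono fun y hy => not_not.2 hy)
  refine le_zero_iff.1 (ge_of_tendsto' (hTV x) fun n => ?_)
  have h1 := (isMarkovLaw_pathKernel (κ := κ) x).measure_inter_shift_preimage
    (m := n) (@MeasurableSet.univ _ (pastAlg E n)) hG
  rw [univ_inter, preimage_compl, shift_preimage_frequencySet, Measure.restrict_univ,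
    ← lintegral_map (f := fun y => pathKernel κ y (frequencySet μ U)ᶜ)
      ((pathKernel κ).measurable_coe hG) (measurable_pi_apply n), pathKernel_map_eval] at h1
  have h2 : pathKernel κ x (frequencySet μ U)ᶜ ≤ (κ ^ n) x N := by
    rw [h1, ← lintegral_indicator_one hN]
    refine lintegral_mono fun y => ?_
    by_cases hy : y ∈ N
    · rw [indicator_of_mem hy]
      exact prob_le_one
    · rw [indicator_of_notMem hy]
      exact (not_not.1 hy).le
  have hpow : IsFiniteMeasure ((κ ^ n) x) := by
    rw [← pathKernel_map_eval]; infer_instance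
  refine h2.trans (le_trans (le_of_eq ?_) (le_iSup₂ (f := fun (A : Set E) (_ : MeasurableSet A) =>
      ENNReal.ofReal |((κ ^ n) x).real A - μ.real A|) N hN))
  have h3 : μ.real N = 0 := by simp [Measure.real, hN0]
  rw [h3, sub_zero, abs_of_nonneg measureReal_nonneg, Measure.real,
    ENNReal.ofReal_toReal (measure_ne_top _ _)]

variable {Ω : Type*} [MeasurableSpace Ω] {P : Measure Ω} [IsProbabilityMeasure P] {X : ℕ → Ω → E}

omit [MeasurableSpace Ω] in
lemma comap_pastAlg (X : ℕ → Ω → E) (n : ℕ) :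
    (pastAlg E n).comap (fun ω i => X i ω) =
      ⨆ (i : ℕ) (_ : i ≤ n), MeasurableSpace.comap (X i) inferInstance := by
  simp only [pastAlg, MeasurableSpace.comap_iSup, MeasurableSpace.comap_comp]
  rfl

/-- The history of `X` is the pullback of the coordinate history, so integrating the conditional
expectation over a past event gives the Markov identity on path space. -/
lemma IsMarkovChain.isMarkovLaw (h : IsMarkovChain X κ P) :
    IsMarkovLaw κ (P.map fun ω i => X i ω) := by
  have hX : Measurable fun ω i => X i ω := measurable_pi_lambda _ h.measurable
  intro n C hC B hB
  have hCm := pastAlg_le n C hC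
  have hle : (⨆ (i : ℕ) (_ : i ≤ n), MeasurableSpace.comap (X i) inferInstance) ≤
      (inferInstance : MeasurableSpace Ω) := iSup₂_le fun i _ => (h.measurable i).comap_le
  have hκ : Measurable fun y => κ y B := κ.measurable_coe hB
  have hf : Measurable fun y : ℕ → E => κ (y n) B := hκ.comp (measurable_pi_apply n)
  have hD : MeasurableSet[⨆ (i : ℕ) (_ : i ≤ n), MeasurableSpace.comap (X i) inferInstance]
      ((fun ω i => X i ω) ⁻¹' C) := by
    rw [← comap_pastAlg]
    exact ⟨C, hC, rfl⟩
  set D := (fun ω i => X i ω) ⁻¹' C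
  rw [Measure.map_apply hX (hCm.inter (measurable_pi_apply (n + 1) hB)),
    setLIntegral_map hCm hf hX]
  change P (D ∩ X (n + 1) ⁻¹' B) = ∫⁻ ω in D, κ (X n ω) B ∂P
  have hXB : MeasurableSet (X (n + 1) ⁻¹' B) := h.measurable (n + 1) hB
  have h1 := setIntegral_condExp hle
    ((integrable_const (1 : ℝ)).indicator (μ := P) hXB) hD
  rw [setIntegral_congr_ae (g := fun ω => (κ (X n ω)).real B) (hle _ hD)
    ((h.condExp_eq n B hB).mono fun ω hω _ => hω), setIntegral_indicator hXB, setIntegral_const,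
    smul_eq_mul, mul_one] at h1
  simp only [Measure.real] at h1
  rw [integral_toReal (f := fun ω => κ (X n ω) B) (hκ.comp (h.measurable n)).aemeasurable
    (ae_of_all _ fun ω => measure_lt_top _ _)] at h1
  refine ((ENNReal.toReal_eq_toReal_iff' ?_ (measure_ne_top _ _)).1 h1).symm
  refine ((lintegral_mono fun ω => prob_le_one (μ := κ (X n ω)) (s := B)).trans_lt ?_).ne
  simp

/-- The law of large numbers for ergodic Markov chains. -/
theorem IsErgodicMarkovChain.ae_mem_frequencySet (h : IsErgodicMarkovChain X κ μ P)
    {U : Set E} (hU : MeasurableSet U) : ∀ᵐ ω ∂P, (fun i => X i ω) ∈ frequencySet μ U := by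
  have hX : Measurable fun ω i => X i ω := measurable_pi_lambda _ h.isMarkovChain.measurable
  have hG := (measurableSet_frequencySet (μ := μ) hU).compl
  have hlaw := h.isMarkovChain.isMarkovLaw.eq_comp
  rw [Measure.map_map (measurable_pi_apply 0) hX] at hlaw
  change P.map _ = pathKernel κ ∘ₘ P.map (X 0) at hlaw
  refine ae_of_ae_map hX.aemeasurable (p := fun x => x ∈ frequencySet μ U) ?_
  rw [hlaw]
  change (pathKernel κ ∘ₘ P.map (X 0)) (frequencySet μ U)ᶜ = 0
  rw [Measure.bind_apply hG (Kernel.aemeasurable _)]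
  refine (lintegral_congr_ae ?_).trans lintegral_zero
  rcases h.ergodic with ⟨htriv, hac⟩ | hTV
  · exact hac.ae_le (measure_compl_frequencySet_comp h.invariant htriv hU)
  · exact ae_of_all _ (pathKernel_compl_frequencySet h.invariant hTV hU)

lemma empiricalMeasure_real (x : ℕ → E) (n : ℕ) {U : Set E} (hU : MeasurableSet U) :
    (empiricalMeasure x n).real U = birkhoffAverage ℝ (shift 1)
      (fun y : ℕ → E => U.indicator (fun _ => (1 : ℝ)) (y 0)) n x := by
  have h : ∀ i, U.indicator (fun _ => (1 : ℝ)) ((shift 1)^[i] x 0) =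
      (U.indicator (fun _ => (1 : ℝ≥0∞)) (x i)).toReal := fun i => by
    rw [shift_one_iterate]
    by_cases hi : x i ∈ U <;> simp [shift, hi]
  simp only [birkhoffAverage, birkhoffSum, h]
  rw [← ENNReal.toReal_sum (fun i _ => by by_cases hi : x i ∈ U <;> simp [hi])]
  simp [Measure.real, empiricalMeasure, Measure.finsetSum_apply, Measure.dirac_apply' _ hU,
    Pi.one_def]

lemma isProbabilityMeasure_empiricalMeasure (x : ℕ → E) {n : ℕ} (hn : n ≠ 0) :
    IsProbabilityMeasure (empiricalMeasure x n) :=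
  ⟨by simp [empiricalMeasure, Measure.finsetSum_apply,
    ENNReal.inv_mul_cancel (Nat.cast_ne_zero.2 hn) (ENNReal.natCast_ne_top n)]⟩

theorem IsErgodicMarkovChain.ae_tendsto_empiricalMeasure (h : IsErgodicMarkovChain X κ μ P)
    {U : Set E} (hU : MeasurableSet U) :
    ∀ᵐ ω ∂P, Tendsto (fun n => (empiricalMeasure (fun i => X i ω) n).real U) atTop
      (𝓝 (μ.real U)) := by
  filter_upwards [h.ae_mem_frequencySet hU] with ω hω
  simp only [empiricalMeasure_real _ _ hU]
  exact hω

end LawOfLargeNumbers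

end MassLoc

end

theorem mainTheorem5
    {E : Type*} [MetricSpace E] [CompleteSpace E] [SecondCountableTopology E]
    [MeasurableSpace E] [BorelSpace E]
    (μ : Measure E) [IsProbabilityMeasure μ]
    (𝓕 : Set (Set E)) (h𝓕 : MassLoc.IsStable 𝓕)
    [PseudoEMetricSpace 𝓕]
    (τ : 𝓕 → ℝ≥0∞)
    (hfin : ∀ a : ℝ, 0 < a → a < 1 → MassLoc.minSize τ μ a < ∞)
    {Ω : Type*} [MeasurableSpace Ω] (P : Measure Ω) [IsProbabilityMeasure P]
    (κ : Kernel E E) [IsMarkovKernel κ]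
    (X : ℕ → Ω → E) (hX : MassLoc.IsErgodicMarkovChain X κ μ P)
    (α : ℝ) (hα0 : 0 < α) (hα1 : α < 1)
    (H2 : MassLoc.DecreasingContinuous τ)
    (H3 : MassLoc.LimLowerSemicontinuous τ)
    (H4 : ContinuousAt (fun a : ℝ => MassLoc.minSize τ μ a) α)
    (H5 : MassLoc.SizeConvImpliesDistConv τ)
    (H6 : MassLoc.FiniteSizeTotallyBounded τ) :
    ∀ᵐ ω ∂P, Tendsto
      (fun n : ℕ => MassLoc.hausContrast
        (MassLoc.minimizers τ (MassLoc.empiricalMeasure (fun i => X i ω) n) α)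
        (MassLoc.minimizers τ μ α))
      atTop (𝓝 0) := by
  -- A nonempty space has a nonempty countable basis, which can therefore be enumerated by `ℕ`.
  have hne : Nonempty E := by
    by_contra hE
    rw [not_nonempty_iff] at hE
    have h := measure_univ (μ := μ)
    rw [Set.univ_eq_empty_iff.2 hE, measure_empty] at h
    exact zero_ne_one h
  have hbasis := TopologicalSpace.isBasis_countableBasis E
  obtain ⟨b, hbr⟩ := (TopologicalSpace.countable_countableBasis E).exists_eq_range
    (by
      obtain ⟨v, hv, -⟩ := hbasis.exists_subset_of_mem_open (mem_univ hne.some) isOpen_univ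
      exact ⟨v, hv⟩)
  rw [hbr] at hbasis
  obtain ⟨D, hD, hDτ⟩ := MassLoc.exists_seq_tendsto_minSize hα0 hα1 hfin H4
  have hU : ∀ s : Finset ℕ, MeasurableSet (⋃ i ∈ s, b i) := fun s =>
    s.measurableSet_biUnion fun i _ => (hbasis.isOpen ⟨i, rfl⟩).measurableSet
  -- Finite subsets of `ℕ` are countable in number, as are the `D j`, so one null set serves all
  -- test sets.
  have h1 := ae_all_iff.2 fun s : Finset ℕ => hX.ae_tendsto_empiricalMeasure (hU s)
  have h2 := ae_all_iff.2 fun j : ℕ =>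
    hX.ae_tendsto_empiricalMeasure (h𝓕.isClosed _ (D j).2).measurableSet
  filter_upwards [h1, h2] with ω hω1 hω2
  exact MassLoc.tendsto_hausContrast_minimizers h𝓕
    -- For `n = 0` the empirical measure is zero, hence the restriction to large `n`.
    ((eventually_ne_atTop 0).mono fun n hn => MassLoc.isProbabilityMeasure_empiricalMeasure _ hn)
    hbasis hω1 (hfin α hα0 hα1) hD hDτ hω2 H3 H5
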